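/- Let $E,F$ be Banach spaces over $\mathbb K=\mathbb R$ or $\mathbb C$, and suppose there is a quotient mapping $\rho\colon E\to F$, that is, a bounded linear map carrying the open unit ball of $E$ onto the open unit ball of $F$. For an integer $n\ge 1$ let $\mathcal P(^nE,F)$ be the space of continuous $n$-homogeneous polynomials $P\colon E\to F$ (continuous maps of the form $P(x)=A(x,\dots,x)$ with $A\colon E^n\to F$ symmetric and $n$-linear), with the norm $\|P\|=\sup\{\|P(x)\|:\|x\|\le 1\}$, and let $\mathcal P_w(^nE,F)$ be the subspace of those $P$ that are weakly continuous on bounded sets, i.e. that map bounded weakly convergent nets to norm convergent nets. A closed subspace $J$ of a normed space $X$ is called an HB-subspace of $X$ if there is a bounded linear projection $q$ on $X^*$ whose kernel is $J^\perp=\{f\in X^*: f(y)=0 \text{ for all } y\in J\}$ such that, for every $f\in X^*$ with $f\neq qf$, $$\|qf\|<\|f\|\quad\text{and}\quad \|f-qf\|\le\|f\|.$$ If $\mathcal P_w(^nE,F)$ is an HB-subspace of $\mathcal P(^nE,F)$ for some integer $n\ge 1$, then $F$ (canonically embedded) is an HB-subspace of its bidual $F^{**}$. -/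

import Mathlib

open scoped Topology

/-- A continuous `n`-homogeneous polynomial `P : E → F`: a continuous function of the form
`P x = A (x, …, x)` for some symmetric `n`-linear map `A : E × ⋯ × E → F`. -/
structure ContHomPoly (𝕜 : Type*) [RCLike 𝕜] (n : ℕ) (E F : Type*)
    [NormedAddCommGroup E] [NormedSpace 𝕜 E] [NormedAddCommGroup F] [NormedSpace 𝕜 F] where
  toFun : E → F
  continuous_toFun : Continuous toFun
  exists_symmetric_multilinear : ∃ A : MultilinearMap 𝕜 (fun _ : Fin n => E) F,
    (∀ (σ : Equiv.Perm (Fin n)) (v : Fin n → E), A (fun i => v (σ i)) = A v) ∧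
    ∀ x : E, toFun x = A (fun _ => x)

namespace ContHomPoly

section

variable {𝕜 : Type*} [RCLike 𝕜] {n : ℕ} {E F : Type*}
  [NormedAddCommGroup E] [NormedSpace 𝕜 E] [NormedAddCommGroup F] [NormedSpace 𝕜 F]

instance : FunLike (ContHomPoly 𝕜 n E F) E F where
  coe := toFun
  coe_injective P Q h := by cases P; cases Q; simpa using h

instance : Zero (ContHomPoly 𝕜 n E F) :=
  ⟨⟨fun _ => 0, continuous_const, 0, fun _ _ => rfl, fun _ => rfl⟩⟩

instance : Add (ContHomPoly 𝕜 n E F) :=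
  ⟨fun P Q => ⟨fun x => P x + Q x, P.continuous_toFun.add Q.continuous_toFun, by
    obtain ⟨A, hA, hPA⟩ := P.exists_symmetric_multilinear
    obtain ⟨B, hB, hQB⟩ := Q.exists_symmetric_multilinear
    exact ⟨A + B, fun σ v => congrArg₂ (· + ·) (hA σ v) (hB σ v),
      fun x => congrArg₂ (· + ·) (hPA x) (hQB x)⟩⟩⟩

instance {R : Type*} [DistribSMul R F] [SMulCommClass 𝕜 R F] [ContinuousConstSMul R F] :
    SMul R (ContHomPoly 𝕜 n E F) :=
  ⟨fun c P => ⟨fun x => c • P x, P.continuous_toFun.const_smul c, by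
    obtain ⟨A, hA, hPA⟩ := P.exists_symmetric_multilinear
    exact ⟨c • A, fun σ v => congrArg (c • ·) (hA σ v), fun x => congrArg (c • ·) (hPA x)⟩⟩⟩

instance : Neg (ContHomPoly 𝕜 n E F) :=
  ⟨fun P => ⟨fun x => -P x, P.continuous_toFun.neg, by
    obtain ⟨A, hA, hPA⟩ := P.exists_symmetric_multilinear
    exact ⟨-A, fun σ v => congrArg (- ·) (hA σ v), fun x => congrArg (- ·) (hPA x)⟩⟩⟩

instance : Sub (ContHomPoly 𝕜 n E F) :=
  ⟨fun P Q => ⟨fun x => P x - Q x, P.continuous_toFun.sub Q.continuous_toFun, by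
    obtain ⟨A, hA, hPA⟩ := P.exists_symmetric_multilinear
    obtain ⟨B, hB, hQB⟩ := Q.exists_symmetric_multilinear
    exact ⟨A - B, fun σ v => congrArg₂ (· - ·) (hA σ v) (hB σ v),
      fun x => congrArg₂ (· - ·) (hPA x) (hQB x)⟩⟩⟩

instance : AddCommGroup (ContHomPoly 𝕜 n E F) :=
  DFunLike.coe_injective.addCommGroup (fun P : ContHomPoly 𝕜 n E F => (P : E → F))
    rfl (fun _ _ => rfl) (fun _ => rfl) (fun _ _ => rfl) (fun _ _ => rfl) (fun _ _ => rfl)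

/-- Evaluation as an additive map to functions. -/
def coeAddHom : ContHomPoly 𝕜 n E F →+ (E → F) where
  toFun P := P
  map_zero' := rfl
  map_add' _ _ := rfl

instance : Module 𝕜 (ContHomPoly 𝕜 n E F) :=
  Function.Injective.module 𝕜 coeAddHom DFunLike.coe_injective (fun _ _ => rfl)

/-- The norm `‖P‖ = sup {‖P x‖ : ‖x‖ ≤ 1}`. -/
noncomputable instance : Norm (ContHomPoly 𝕜 n E F) :=
  ⟨fun P => sSup ((fun x => ‖P x‖) '' Metric.closedBall (0 : E) 1)⟩

theorem norm_def (P : ContHomPoly 𝕜 n E F) :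
    ‖P‖ = sSup ((fun x => ‖P x‖) '' Metric.closedBall (0 : E) 1) := rfl

@[ext] theorem ext {P Q : ContHomPoly 𝕜 n E F} (h : ∀ x, P x = Q x) : P = Q :=
  DFunLike.ext _ _ h

@[simp] theorem zero_apply (x : E) : (0 : ContHomPoly 𝕜 n E F) x = 0 := rfl

@[simp] theorem add_apply (P Q : ContHomPoly 𝕜 n E F) (x : E) : (P + Q) x = P x + Q x := rfl

@[simp] theorem smul_apply (c : 𝕜) (P : ContHomPoly 𝕜 n E F) (x : E) :
    (c • P) x = c • P x := rfl

theorem map_smul_pow (P : ContHomPoly 𝕜 n E F) (c : 𝕜) (x : E) : P (c • x) = c ^ n • P x := by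
  obtain ⟨A, -, hPA⟩ := P.exists_symmetric_multilinear
  have h : ∀ y, P y = A (fun _ => y) := hPA
  rw [h, h]
  simpa using A.map_smul_univ (fun _ => c) (fun _ => x)

theorem bddAbove (P : ContHomPoly 𝕜 n E F) :
    BddAbove ((fun x => ‖P x‖) '' Metric.closedBall (0 : E) 1) := by
  have hc : ContinuousAt P (0 : E) := P.continuous_toFun.continuousAt
  obtain ⟨δ, hδ, h⟩ := Metric.continuousAt_iff.1 hc 1 one_pos
  refine ⟨((δ / 2) ^ n)⁻¹ * (1 + ‖P 0‖), ?_⟩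
  rintro _ ⟨x, hx, rfl⟩
  rw [mem_closedBall_zero_iff] at hx
  have hn : ‖((δ / 2 : ℝ) : 𝕜)‖ = δ / 2 := by
    rw [RCLike.norm_ofReal, abs_of_pos (by positivity)]
  have h1 : dist (((δ / 2 : ℝ) : 𝕜) • x) 0 < δ := by
    rw [dist_zero_right, norm_smul, hn]
    nlinarith
  have h2 := h h1
  rw [map_smul_pow, dist_eq_norm] at h2
  have h3 : ‖(((δ / 2 : ℝ) : 𝕜)) ^ n • P x‖ ≤ 1 + ‖P 0‖ := by
    have := norm_le_norm_sub_add ((((δ / 2 : ℝ) : 𝕜)) ^ n • P x) (P 0)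
    linarith
  rw [norm_smul, norm_pow, hn] at h3
  change ‖P x‖ ≤ _
  rw [inv_mul_eq_div, le_div_iff₀ (by positivity)]
  linarith

theorem norm_apply_le_of_norm_le_one (P : ContHomPoly 𝕜 n E F) {x : E} (hx : ‖x‖ ≤ 1) :
    ‖P x‖ ≤ ‖P‖ :=
  le_csSup P.bddAbove ⟨x, by simpa using hx, rfl⟩

theorem norm_le_of_forall (P : ContHomPoly 𝕜 n E F) {C : ℝ}
    (h : ∀ x, ‖x‖ ≤ 1 → ‖P x‖ ≤ C) : ‖P‖ ≤ C := by
  refine csSup_le ⟨_, 0, by simp, rfl⟩ ?_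
  rintro _ ⟨x, hx, rfl⟩
  exact h x (by simpa using hx)

theorem norm_nonneg' (P : ContHomPoly 𝕜 n E F) : 0 ≤ ‖P‖ :=
  (norm_nonneg _).trans (P.norm_apply_le_of_norm_le_one (x := 0) (by simp))

theorem norm_smul_le' (c : 𝕜) (P : ContHomPoly 𝕜 n E F) : ‖c • P‖ ≤ ‖c‖ * ‖P‖ :=
  norm_le_of_forall _ fun x hx => by
    rw [smul_apply, norm_smul]
    exact mul_le_mul_of_nonneg_left (P.norm_apply_le_of_norm_le_one hx) (norm_nonneg c)

theorem eq_zero_of_norm_eq_zero (P : ContHomPoly 𝕜 n E F) (h : ‖P‖ = 0) : P = 0 := by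
  ext x
  have hpos : (0 : ℝ) < 1 + ‖x‖ := by positivity
  have hn : ‖((1 + ‖x‖ : ℝ) : 𝕜)‖ = 1 + ‖x‖ := by
    rw [RCLike.norm_ofReal, abs_of_pos hpos]
  have hne : ((1 + ‖x‖ : ℝ) : 𝕜) ≠ 0 := by
    rw [← norm_pos_iff, hn]; exact hpos
  have h1 : ‖((1 + ‖x‖ : ℝ) : 𝕜)⁻¹ • x‖ ≤ 1 := by
    rw [norm_smul, norm_inv, hn, inv_mul_le_iff₀ hpos]
    linarith
  have h2 := P.norm_apply_le_of_norm_le_one h1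
  rw [h, norm_le_zero_iff, map_smul_pow] at h2
  simpa using (smul_eq_zero_iff_right (pow_ne_zero n (inv_ne_zero hne))).1 h2

theorem normedSpaceCore : NormedSpace.Core 𝕜 (ContHomPoly 𝕜 n E F) where
  norm_nonneg P := P.norm_nonneg'
  norm_smul c P := by
    refine le_antisymm (norm_smul_le' c P) ?_
    rcases eq_or_ne c 0 with rfl | hc
    · simpa using norm_nonneg' ((0 : 𝕜) • P)
    · have h := norm_smul_le' c⁻¹ (c • P)
      rw [inv_smul_smul₀ hc, norm_inv] at h
      rwa [← le_inv_mul_iff₀ (norm_pos_iff.2 hc)]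
  norm_triangle P Q := norm_le_of_forall _ fun x hx =>
    (norm_add_le _ _).trans
      (add_le_add (P.norm_apply_le_of_norm_le_one hx) (Q.norm_apply_le_of_norm_le_one hx))
  norm_eq_zero_iff P := by
    refine ⟨P.eq_zero_of_norm_eq_zero, ?_⟩
    rintro rfl
    exact le_antisymm (norm_le_of_forall _ fun x _ => by simp) (norm_nonneg' _)

noncomputable instance : NormedAddCommGroup (ContHomPoly 𝕜 n E F) :=
  NormedAddCommGroup.ofCore normedSpaceCore

noncomputable instance : NormedSpace 𝕜 (ContHomPoly 𝕜 n E F) :=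
  NormedSpace.ofCore normedSpaceCore

end

end ContHomPoly

/-- `P : E → F` is weakly continuous on bounded sets: its restriction to every bounded set is
continuous from the weak topology of `E` to the norm topology of `F`. Equivalently, `P` maps
bounded weakly convergent nets to norm convergent nets. -/
def WeaklyContinuousOnBounded (𝕜 : Type*) [RCLike 𝕜] {E F : Type*}
    [NormedAddCommGroup E] [NormedSpace 𝕜 E] [NormedAddCommGroup F] (P : E → F) : Prop :=
  ∀ s : Set E, Bornology.IsBounded s →
    ContinuousOn (fun x : WeakSpace 𝕜 E => P ((toWeakSpace 𝕜 E).symm x))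
      (toWeakSpace 𝕜 E '' s)

/-- The subspace of those continuous `n`-homogeneous polynomials `E → F` that are weakly
continuous on bounded sets. -/
def wPoly (𝕜 : Type*) [RCLike 𝕜] (n : ℕ) (E F : Type*)
    [NormedAddCommGroup E] [NormedSpace 𝕜 E] [NormedAddCommGroup F] [NormedSpace 𝕜 F] :
    Submodule 𝕜 (ContHomPoly 𝕜 n E F) where
  carrier := {P | WeaklyContinuousOnBounded 𝕜 P}
  zero_mem' := fun _ _ => continuousOn_const
  add_mem' := fun hP hQ s hs => (hP s hs).add (hQ s hs)
  smul_mem' := fun c _ hP s hs => (hP s hs).const_smul c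

/-- `J` is an HB-subspace of `X`: it is closed, and there is a (bounded linear) projection `q` on
the dual `X*` whose kernel is the annihilator of `J`, such that `‖q f‖ < ‖f‖` and
`‖f - q f‖ ≤ ‖f‖` for every `f ∈ X*` with `f ≠ q f`. -/
def IsHBSubspace {𝕜 X : Type*} [RCLike 𝕜] [NormedAddCommGroup X] [NormedSpace 𝕜 X]
    (J : Submodule 𝕜 X) : Prop :=
  IsClosed (J : Set X) ∧
  ∃ q : StrongDual 𝕜 X →L[𝕜] StrongDual 𝕜 X,
    (∀ f, q (q f) = q f) ∧
    (∀ f, q f = 0 ↔ ∀ y ∈ J, f y = 0) ∧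
    ∀ f, f ≠ q f → ‖q f‖ < ‖f‖ ∧ ‖f - q f‖ ≤ ‖f‖

/-- A quotient mapping of Banach spaces: a bounded linear map carrying the open unit ball of `E`
onto the open unit ball of `F` (so `F` carries the quotient norm of `E / ker ρ`). -/
def IsQuotientMapping {𝕜 E F : Type*} [RCLike 𝕜] [NormedAddCommGroup E] [NormedSpace 𝕜 E]
    [NormedAddCommGroup F] [NormedSpace 𝕜 F] (ρ : E →L[𝕜] F) : Prop :=
  ρ '' Metric.ball (0 : E) 1 = Metric.ball (0 : F) 1

/-! The required projection on `F***` is the canonical one: restrict `f` to `F`, getting `g`, and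
view `g` as a functional on `F**`. Suppose `f Y ≠ Y g` for some `Y` in `F**`. Goldstine's theorem
and the quotient map give an ultrafilter `U` on the open ball of radius `‖Y‖` in `E` along which `ρ
x` tends weak-star to `Y`. Weak-star limits of values along `U` define `Λ` from polynomials to
`F**`, with norm at most `‖Y‖ ^ n`. Put `Φ = f ∘ Λ` and `Γ P = Λ P g`.

A polynomial weakly continuous on bounded sets has a norm limit along `U`
(`WeaklyContinuousOnBounded.exists_tendsto`), so `Λ` sends it into `F`, where `f` and `g` agree.
Hence `Φ - Γ` annihilates the subspace and `q Φ = q Γ`. The polynomials `φ (ρ x) ^ n • z` show that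
`Γ` attains its norm on the subspace, so `q Γ = Γ`. The polynomials `φ (ρ x) ^ (n - 1) • ρ x` are
sent to `Y φ ^ (n - 1) • Y` and separate `Φ` from `Γ`. The HB inequalities for `Φ`, divided by
powers of `‖Y‖`, are the desired ones for `f`. -/

open Filter

/-- The dual of a normed space, with the topology of the space taken from its norm. -/
abbrev NormedDual (𝕜 X : Type*) [RCLike 𝕜] [NormedAddCommGroup X] [NormedSpace 𝕜 X] :=
  StrongDual 𝕜 X

/-! ### Finite differences of polynomials -/

section FiniteDifferences

variable {E F : Type*} [AddCommGroup E] [AddCommGroup F]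

/-- `f` has difference degree at most `n`: all its `(n + 1)`-fold differences vanish. -/
def HasDiffDegreeLE : ℕ → (E → F) → Prop
  | 0, f => ∃ c, ∀ x, f x = c
  | n + 1, f => ∀ a, HasDiffDegreeLE n fun x => f (x + a) - f x

theorem HasDiffDegreeLE.add {n : ℕ} {f g : E → F} (hf : HasDiffDegreeLE n f)
    (hg : HasDiffDegreeLE n g) : HasDiffDegreeLE n fun x => f x + g x := by
  induction n generalizing f g with
  | zero =>
    obtain ⟨c, hc⟩ := hf
    obtain ⟨d, hd⟩ := hg
    exact ⟨c + d, fun x => congrArg₂ (· + ·) (hc x) (hd x)⟩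
  | succ n ih =>
    intro a
    simpa only [add_sub_add_comm] using ih (hf a) (hg a)

theorem HasDiffDegreeLE.zero (n : ℕ) : HasDiffDegreeLE n fun _ : E => (0 : F) := by
  induction n with
  | zero => exact ⟨0, fun _ => rfl⟩
  | succ n ih => intro a; simpa using ih

theorem HasDiffDegreeLE.sum {n : ℕ} {ι : Type*} (s : Finset ι) {f : ι → E → F}
    (hf : ∀ i ∈ s, HasDiffDegreeLE n (f i)) : HasDiffDegreeLE n fun x => ∑ i ∈ s, f i x := by
  classical
  induction s using Finset.induction_on with
  | empty => simpa using HasDiffDegreeLE.zero n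
  | insert i s hi ih =>
    simp only [Finset.sum_insert hi]
    exact (hf i (Finset.mem_insert_self i s)).add
      (ih fun j hj => hf j (Finset.mem_insert_of_mem hj))

/-- Freezing some arguments at `c` makes the induction close: differencing turns some of the free
slots into constants. -/
theorem MultilinearMap.hasDiffDegreeLE_piecewise {𝕜 ι : Type*} [Field 𝕜] [Module 𝕜 E]
    [Module 𝕜 F] [DecidableEq ι] (A : MultilinearMap 𝕜 (fun _ : ι => E) F) (k : ℕ)
    (s : Finset ι) (hs : s.card ≤ k) (c : ι → E) :
    HasDiffDegreeLE k fun x => A (s.piecewise (fun _ => x) c) := by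
  induction k generalizing s c with
  | zero =>
    obtain rfl : s = ∅ := by simpa using hs
    exact ⟨A c, fun x => by simp⟩
  | succ k ih =>
    intro a
    -- Expanding by multilinearity, the term with `t = s` cancels; the others have strictly fewer
    -- free slots.
    have h : ∀ x, A (s.piecewise (fun _ => x + a) c) - A (s.piecewise (fun _ => x) c)
        = ∑ t ∈ s.powerset.erase s, A (t.piecewise (fun _ => x) (s.piecewise (fun _ => a) c)) := by
      intro x
      have h1 := A.map_piecewise_add (fun _ => x) (s.piecewise (fun _ => a) c) s
      have h2 : s.piecewise ((fun _ => x) + s.piecewise (fun _ => a) c)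
          (s.piecewise (fun _ => a) c) = s.piecewise (fun _ => x + a) c := by
        ext i
        by_cases hi : i ∈ s <;> simp [hi]
      have h3 : s.piecewise (fun _ => x) (s.piecewise (fun _ => a) c)
          = s.piecewise (fun _ => x) c := by
        ext i
        by_cases hi : i ∈ s <;> simp [hi]
      rw [h2, ← Finset.sum_erase_add _ _ (Finset.mem_powerset_self s), h3] at h1
      rw [h1, add_sub_cancel_right]
    simp only [h]
    refine HasDiffDegreeLE.sum _ fun t ht => ih t ?_ _
    rw [Finset.mem_erase, Finset.mem_powerset] at ht
    have := Finset.card_lt_card (ht.2.ssubset_of_ne ht.1)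
    omega

end FiniteDifferences

theorem ContHomPoly.hasDiffDegreeLE {𝕜 : Type*} [RCLike 𝕜] {n : ℕ} {E F : Type*}
    [NormedAddCommGroup E] [NormedSpace 𝕜 E] [NormedAddCommGroup F] [NormedSpace 𝕜 F]
    (P : ContHomPoly 𝕜 n E F) : HasDiffDegreeLE n P := by
  obtain ⟨A, -, hA⟩ := P.exists_symmetric_multilinear
  have h := A.hasDiffDegreeLE_piecewise n Finset.univ (by simp) 0
  simp only [Finset.piecewise_univ, ← hA] at h
  exact h

/-! ### Limits along bounded weakly Cauchy filters -/

section WeakContinuity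

variable {𝕜 : Type*} [RCLike 𝕜] {E F : Type*} [NormedAddCommGroup E] [NormedSpace 𝕜 E]
  [NormedAddCommGroup F]

theorem tendsto_toWeakSpace {ι : Type*} {l : Filter ι} {g : ι → E} {x : E}
    (h : ∀ ψ : NormedDual 𝕜 E, Tendsto (fun i => ψ (g i)) l (𝓝 (ψ x))) :
    Tendsto (fun i => toWeakSpace 𝕜 E (g i)) l (𝓝 (toWeakSpace 𝕜 E x)) := by
  have hn : 𝓝 (toWeakSpace 𝕜 E x)
      = comap (fun (z : WeakSpace 𝕜 E) (ψ : NormedDual 𝕜 E) => (topDualPairing 𝕜 E).flip z ψ)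
        (𝓝 fun ψ => ψ x) := nhds_induced _ _
  rw [hn, tendsto_comap_iff]
  exact tendsto_pi_nhds.2 h

theorem WeaklyContinuousOnBounded.tendsto {P : E → F} (hP : WeaklyContinuousOnBounded 𝕜 P)
    {ι : Type*} {l : Filter ι} {g : ι → E} {x : E} {s : Set E} (hs : Bornology.IsBounded s)
    (hx : x ∈ s) (hg : ∀ᶠ i in l, g i ∈ s)
    (h : ∀ ψ : NormedDual 𝕜 E, Tendsto (fun i => ψ (g i)) l (𝓝 (ψ x))) :
    Tendsto (fun i => P (g i)) l (𝓝 (P x)) := by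
  have h1 := hP s hs (toWeakSpace 𝕜 E x) ⟨x, hx, rfl⟩
  have h2 : Tendsto (fun i => toWeakSpace 𝕜 E (g i)) l
      (𝓝[toWeakSpace 𝕜 E '' s] toWeakSpace 𝕜 E x) :=
    tendsto_nhdsWithin_iff.2 ⟨tendsto_toWeakSpace h, hg.mono fun i hi => ⟨_, hi, rfl⟩⟩
  simpa [Function.comp_def] using h1.tendsto.comp h2

theorem WeaklyContinuousOnBounded.sub {P Q : E → F} (hP : WeaklyContinuousOnBounded 𝕜 P)
    (hQ : WeaklyContinuousOnBounded 𝕜 Q) : WeaklyContinuousOnBounded 𝕜 fun x => P x - Q x :=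
  fun s hs => (hP s hs).sub (hQ s hs)

theorem WeaklyContinuousOnBounded.comp_add_right {P : E → F}
    (hP : WeaklyContinuousOnBounded 𝕜 P) (a : E) :
    WeaklyContinuousOnBounded 𝕜 fun x => P (x + a) := by
  intro s hs
  have hb : Bornology.IsBounded ((fun x => x + a) '' s) :=
    (LipschitzWith.id.add (LipschitzWith.const a)).isBounded_image hs
  have hc : Continuous fun x : WeakSpace 𝕜 E => x + toWeakSpace 𝕜 E a := by fun_prop
  have h := (hP _ hb).comp (s := toWeakSpace 𝕜 E '' s) hc.continuousOn (by
    rintro _ ⟨x, hx, rfl⟩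
    exact ⟨x + a, ⟨x, hx, rfl⟩, map_add _ _ _⟩)
  simpa [Function.comp_def] using h

/-- The centre `w` may depend on `ε`, which suits limits known only up to a small error. -/
theorem cauchy_map_of_forall_eventually_dist_lt {α X : Type*} [PseudoMetricSpace X]
    {l : Filter α} [l.NeBot] {f : α → X}
    (h : ∀ ε > 0, ∃ w, ∀ᶠ x in l, dist (f x) w < ε) : Cauchy (map f l) := by
  refine Metric.cauchy_iff.2 ⟨inferInstance, fun ε hε => ?_⟩
  obtain ⟨w, hw⟩ := h (ε / 2) (half_pos hε)
  refine ⟨Metric.ball w (ε / 2), hw, fun x hx y hy => ?_⟩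
  rw [Metric.mem_ball] at hx hy
  linarith [dist_triangle_right x y w]

/-- Functions of finite difference degree that are weakly continuous on bounded sets have norm
limits along bounded filters that are weakly Cauchy. -/
theorem WeaklyContinuousOnBounded.exists_tendsto [CompleteSpace F] {U : Filter E} [U.NeBot]
    {r : ℝ} (hr : Metric.ball 0 r ∈ U)
    (hU : ∀ ψ : NormedDual 𝕜 E, ∃ c, Tendsto ψ U (𝓝 c)) {n : ℕ} {f : E → F}
    (hd : HasDiffDegreeLE n f) (hf : WeaklyContinuousOnBounded 𝕜 f) :
    ∃ z, Tendsto f U (𝓝 z) := by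
  induction n generalizing f with
  | zero =>
    obtain ⟨c, hc⟩ := hd
    exact ⟨c, tendsto_const_nhds.congr fun x => (hc x).symm⟩
  | succ n ih =>
    -- Differences of a bounded weakly Cauchy filter are bounded and weakly null.
    have hlim : Tendsto (fun p : E × E => f (p.2 - p.1)) (U ×ˢ U) (𝓝 (f 0)) := by
      refine hf.tendsto (s := Metric.ball 0 (r + r)) Metric.isBounded_ball ?_ ?_ ?_
      · obtain ⟨x, hx⟩ := nonempty_of_mem hr
        have : 0 < r := Metric.pos_of_mem_ball hx
        exact Metric.mem_ball_self (by linarith)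
      · filter_upwards [prod_mem_prod hr hr] with p hp
        have h1 := mem_ball_zero_iff.1 hp.1
        have h2 := mem_ball_zero_iff.1 hp.2
        rw [mem_ball_zero_iff]
        linarith [norm_sub_le p.2 p.1]
      · intro ψ
        obtain ⟨c, hc⟩ := hU ψ
        simpa using (hc.comp tendsto_snd).sub (hc.comp (tendsto_fst (f := U) (g := U)))
    refine cauchy_map_iff_exists_tendsto.1 (cauchy_map_of_forall_eventually_dist_lt ?_)
    intro ε hε
    have h1 : ∀ᶠ p : E × E in U ×ˢ U, dist (f (p.2 - p.1)) (f 0) < ε / 2 :=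
      hlim.eventually (Metric.ball_mem_nhds _ (half_pos hε))
    -- Fix one `a` with `f (x - a)` close to `f 0` for `U`-most `x`. As `f (x - a) - f x` has lower
    -- degree, it converges to some `w`, so `f x` is eventually close to `f 0 - w`.
    obtain ⟨a, ha⟩ := h1.curry.exists
    obtain ⟨w, hw⟩ := ih (hd (-a)) ((hf.comp_add_right (-a)).sub hf)
    refine ⟨f 0 - w, ?_⟩
    filter_upwards [ha, hw.eventually (Metric.ball_mem_nhds _ (half_pos hε))] with x hx1 hx2
    rw [dist_eq_norm] at hx1
    rw [dist_eq_norm, ← sub_eq_add_neg] at hx2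
    rw [dist_eq_norm]
    have : f x - (f 0 - w) = (f (x - a) - f 0) - (f (x - a) - f x - w) := by abel
    rw [this]
    linarith [norm_sub_le (f (x - a) - f 0) (f (x - a) - f x - w)]

end WeakContinuity

/-! ### Quotient maps, Goldstine's theorem and ultrafilter limits -/

section Bidual

variable {𝕜 : Type*} [RCLike 𝕜] {E F : Type*} [NormedAddCommGroup E] [NormedSpace 𝕜 E]
  [NormedAddCommGroup F] [NormedSpace 𝕜 F]

theorem IsQuotientMapping.norm_apply_le {ρ : E →L[𝕜] F} (hρ : IsQuotientMapping ρ) (x : E) :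
    ‖ρ x‖ ≤ ‖x‖ := by
  refine le_of_forall_gt_imp_ge_of_dense fun r hr => ?_
  have hr0 : 0 < r := (norm_nonneg x).trans_lt hr
  have hn : ‖((r : ℝ) : 𝕜)‖ = r := by rw [RCLike.norm_ofReal, abs_of_pos hr0]
  have h : ρ (((r : ℝ) : 𝕜)⁻¹ • x) ∈ Metric.ball (0 : F) 1 := by
    rw [← hρ]
    refine ⟨_, ?_, rfl⟩
    rw [mem_ball_zero_iff, norm_smul, norm_inv, hn, inv_mul_lt_iff₀ hr0]
    linarith
  rw [map_smul, mem_ball_zero_iff, norm_smul, norm_inv, hn, inv_mul_lt_iff₀ hr0] at h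
  linarith

theorem IsQuotientMapping.exists_apply_eq {ρ : E →L[𝕜] F} (hρ : IsQuotientMapping ρ) {r : ℝ}
    {y : F} (hy : ‖y‖ < r) : ∃ x, ‖x‖ < r ∧ ρ x = y := by
  have hr0 : 0 < r := (norm_nonneg y).trans_lt hy
  have hn : ‖((r : ℝ) : 𝕜)‖ = r := by rw [RCLike.norm_ofReal, abs_of_pos hr0]
  have hne : ((r : ℝ) : 𝕜) ≠ 0 := by rw [← norm_pos_iff, hn]; exact hr0
  have h : ((r : ℝ) : 𝕜)⁻¹ • y ∈ ρ '' Metric.ball (0 : E) 1 := by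
    rw [hρ, mem_ball_zero_iff, norm_smul, norm_inv, hn, inv_mul_lt_iff₀ hr0]
    linarith
  obtain ⟨x, hx, hxy⟩ := h
  refine ⟨((r : ℝ) : 𝕜) • x, ?_, ?_⟩
  · rw [mem_ball_zero_iff] at hx
    rw [norm_smul, hn]
    nlinarith
  · rw [map_smul, hxy, smul_inv_smul₀ hne]

/-- If the real part of a functional is bounded on an open ball, this bounds its norm. -/
theorem norm_mul_le_of_forall_re_le {φ : NormedDual 𝕜 F} {r u : ℝ} (hr : 0 < r)
    (h : ∀ y, ‖y‖ < r → RCLike.re (φ y) ≤ u) : ‖φ‖ * r ≤ u := by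
  rw [← le_div_iff₀ hr]
  refine le_of_forall_lt fun t ht => ?_
  obtain ⟨y, hy1, hy2⟩ := φ.exists_lt_apply_of_lt_opNorm ht
  -- Rotating by a unimodular scalar turns the real-part bound into a modulus bound.
  obtain ⟨c, hc1, hc2⟩ := RCLike.exists_norm_eq_mul_self (φ y)
  refine hy2.trans_le ?_
  rw [le_div_iff₀ hr]
  have h1 := h (((r : ℝ) : 𝕜) • c • y) (by
    rw [norm_smul, norm_smul, hc1, RCLike.norm_ofReal, abs_of_pos hr, one_mul]
    nlinarith)
  rw [φ.map_smul, φ.map_smul, smul_eq_mul, smul_eq_mul, ← hc2, ← RCLike.ofReal_mul,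
    RCLike.ofReal_re] at h1
  linarith

/-- Helly's form of Goldstine's theorem: an element `Y` of the bidual is approximated on finitely
many functionals by elements of norm less than `‖Y‖`. -/
theorem mem_closure_eval_ball {Y : NormedDual 𝕜 (NormedDual 𝕜 F)} (hY : Y ≠ 0)
    (I : Finset (NormedDual 𝕜 F)) :
    (fun i : I => Y i) ∈
      closure {g : I → 𝕜 | ∃ y : F, ‖y‖ < ‖Y‖ ∧ g = fun i : I => (i : NormedDual 𝕜 F) y} := by
  classical
  have hR : 0 < ‖Y‖ := norm_pos_iff.2 hY
  set s := {g : I → 𝕜 | ∃ y : F, ‖y‖ < ‖Y‖ ∧ g = fun i : I => (i : NormedDual 𝕜 F) y}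
  have hconv : Convex ℝ s := by
    rintro _ ⟨y, hy, rfl⟩ _ ⟨z, hz, rfl⟩ a b ha hb hab
    refine ⟨(a : 𝕜) • y + (b : 𝕜) • z, ?_, ?_⟩
    · calc ‖(a : 𝕜) • y + (b : 𝕜) • z‖ ≤ ‖(a : 𝕜) • y‖ + ‖(b : 𝕜) • z‖ := norm_add_le _ _
        _ = a * ‖y‖ + b * ‖z‖ := by
          rw [norm_smul, norm_smul, RCLike.norm_ofReal, RCLike.norm_ofReal, abs_of_nonneg ha,
            abs_of_nonneg hb]
        _ ≤ a * max ‖y‖ ‖z‖ + b * max ‖y‖ ‖z‖ := by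
          gcongr
          · exact le_max_left _ _
          · exact le_max_right _ _
        _ = max ‖y‖ ‖z‖ := by rw [← add_mul, hab, one_mul]
        _ < ‖Y‖ := max_lt hy hz
    · ext i
      simp [RCLike.real_smul_eq_coe_mul]
  by_contra hnot
  obtain ⟨c, u, hc, hu⟩ := RCLike.geometric_hahn_banach_closed_point (𝕜 := 𝕜)
    hconv.closure isClosed_closure hnot
  -- The separating functional on `𝕜^I` is a linear combination of coordinates; the same combination
  -- `φ` of the functionals in `I` has `‖φ‖ * ‖Y‖ ≤ u < re (Y φ)`, which is absurd.
  have hsum : ∀ g : I → 𝕜, c g = ∑ i, c (Pi.single i 1) * g i := fun g => by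
    conv_lhs => rw [pi_eq_sum_univ' g]
    rw [map_sum]
    refine Finset.sum_congr rfl fun i _ => ?_
    rw [map_smul, smul_eq_mul, mul_comm]
  let φ : NormedDual 𝕜 F := ∑ i : I, c (Pi.single i 1) • (i : NormedDual 𝕜 F)
  have h1 : ‖φ‖ * ‖Y‖ ≤ u := norm_mul_le_of_forall_re_le hR fun y hy => by
    have h := hc _ (subset_closure ⟨y, hy, rfl⟩)
    rw [hsum] at h
    refine le_of_eq_of_le ?_ h.le
    simp [φ]
  have h2 : Y φ = c fun i : I => Y i := by
    rw [hsum]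
    simp [φ]
  rw [← h2] at hu
  linarith [RCLike.re_le_norm (Y φ), Y.le_opNorm φ]

/-- Every nonzero element of the bidual of a quotient of `E` is the weak-star limit of the images
of elements of `E` along an ultrafilter on the open ball of the same radius. -/
theorem IsQuotientMapping.exists_ultrafilter {ρ : E →L[𝕜] F} (hρ : IsQuotientMapping ρ)
    {Y : NormedDual 𝕜 (NormedDual 𝕜 F)} (hY : Y ≠ 0) :
    ∃ U : Ultrafilter E, Metric.ball 0 ‖Y‖ ∈ U ∧
      ∀ φ : NormedDual 𝕜 F, Tendsto (fun x => φ (ρ x)) U (𝓝 (Y φ)) := by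
  let h : E → NormedDual 𝕜 F → 𝕜 := fun x φ => φ (ρ x)
  -- A basic product neighbourhood tests finitely many functionals, so Helly's theorem gives a point
  -- of `F`, which lifts through `ρ` without leaving the open ball.
  have hne : (comap h (𝓝 fun φ => Y φ) ⊓ 𝓟 (Metric.ball (0 : E) ‖Y‖)).NeBot := by
    rw [inf_principal_neBot_iff]
    rintro t ⟨V, hV, hVt⟩
    obtain ⟨V', hV'V, hV'o, hYV'⟩ := mem_nhds_iff.1 hV
    obtain ⟨I, u, hu, huV⟩ := isOpen_pi_iff.1 hV'o _ hYV'
    have hopen : IsOpen (Set.univ.pi fun i : I => u i) :=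
      isOpen_set_pi Set.finite_univ fun i _ => (hu i i.2).1
    obtain ⟨_, hg, y, hy, rfl⟩ := mem_closure_iff.1 (mem_closure_eval_ball hY I) _ hopen
      fun i _ => (hu i i.2).2
    obtain ⟨x, hx, rfl⟩ := hρ.exists_apply_eq hy
    exact ⟨x, hVt (hV'V (huV fun i hi => hg ⟨i, hi⟩ trivial)), mem_ball_zero_iff.2 hx⟩
  obtain ⟨U, hU⟩ := Ultrafilter.exists_le
    (comap h (𝓝 fun φ => Y φ) ⊓ 𝓟 (Metric.ball (0 : E) ‖Y‖))
  refine ⟨U, le_principal_iff.1 (hU.trans inf_le_right), fun φ => ?_⟩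
  exact tendsto_pi_nhds.1 (tendsto_iff_comap.2 (hU.trans inf_le_left)) φ

theorem Ultrafilter.exists_tendsto_of_norm_le {α V : Type*} [NormedAddCommGroup V] [ProperSpace V]
    (U : Ultrafilter α) {g : α → V} {C : ℝ} (hg : ∀ᶠ x in U, ‖g x‖ ≤ C) :
    ∃ c, Tendsto g U (𝓝 c) ∧ ‖c‖ ≤ C := by
  obtain ⟨c, hc, hUc⟩ := (isCompact_closedBall (0 : V) C).ultrafilter_le_nhds (U.map g)
    (le_principal_iff.2 (hg.mono fun x hx => mem_closedBall_zero_iff.2 hx))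
  exact ⟨c, hUc, by simpa using hc⟩

/-- A bound for the powers of the norm of a functional can be tested on its values. -/
theorem norm_pow_mul_le_of_forall {V : Type*} [NormedAddCommGroup V] [NormedSpace 𝕜 V]
    {Y : NormedDual 𝕜 V} (hY : Y ≠ 0) (m : ℕ) {a C : ℝ} (ha : 0 ≤ a) (hC : 0 ≤ C)
    (h : ∀ φ, ‖Y φ‖ ^ m * a ≤ C * ‖φ‖ ^ m) : ‖Y‖ ^ m * a ≤ C := by
  -- `Y` need not attain its norm, so the bound is proved for `t < ‖Y‖` and passed to the limit.
  have hcont : Tendsto (fun t : ℝ => t ^ m * a) (𝓝[<] ‖Y‖) (𝓝 (‖Y‖ ^ m * a)) :=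
    ((continuous_id.pow m).mul continuous_const).continuousAt.mono_left nhdsWithin_le_nhds
  refine le_of_tendsto hcont ?_
  filter_upwards [Ioo_mem_nhdsLT (norm_pos_iff.2 hY)] with t ht
  obtain ⟨φ, hφ1, hφ2⟩ := Y.exists_lt_apply_of_lt_opNorm ht.2
  calc t ^ m * a ≤ ‖Y φ‖ ^ m * a := by
        gcongr
        exact ht.1.le
    _ ≤ C * ‖φ‖ ^ m := h φ
    _ ≤ C * 1 := by
        gcongr
        exact pow_le_one₀ (norm_nonneg _) hφ1.le
    _ = C := mul_one C

end Bidual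

/-! ### Test polynomials and the limit operator -/

namespace ContHomPoly

variable {𝕜 : Type*} [RCLike 𝕜] {n : ℕ} {E F : Type*} [NormedAddCommGroup E] [NormedSpace 𝕜 E]
  [NormedAddCommGroup F] [NormedSpace 𝕜 F]

theorem norm_apply_le (P : ContHomPoly 𝕜 n E F) {r : ℝ} (hr : 0 < r) {x : E} (hx : ‖x‖ ≤ r) :
    ‖P x‖ ≤ r ^ n * ‖P‖ := by
  have hn : ‖((r : ℝ) : 𝕜)‖ = r := by rw [RCLike.norm_ofReal, abs_of_pos hr]
  have hne : ((r : ℝ) : 𝕜) ≠ 0 := by rw [← norm_pos_iff, hn]; exact hr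
  have h := P.norm_apply_le_of_norm_le_one (x := ((r : ℝ) : 𝕜)⁻¹ • x) (by
    rwa [norm_smul, norm_inv, hn, inv_mul_le_iff₀ hr, mul_one])
  rwa [map_smul_pow, norm_smul, norm_pow, norm_inv, hn, inv_pow,
    inv_mul_le_iff₀ (pow_pos hr n)] at h

/-- A continuous function given by a multilinear map on the diagonal is a continuous homogeneous
polynomial: the multilinear map can be symmetrized. -/
noncomputable def ofMultilinear (f : E → F) (hf : Continuous f)
    (A : MultilinearMap 𝕜 (fun _ : Fin n => E) F) (hA : ∀ x, f x = A fun _ => x) :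
    ContHomPoly 𝕜 n E F where
  toFun := f
  continuous_toFun := hf
  exists_symmetric_multilinear := by
    refine ⟨((Fintype.card (Equiv.Perm (Fin n)) : 𝕜))⁻¹ •
      ∑ σ : Equiv.Perm (Fin n), A.domDomCongr σ, fun τ v => ?_, fun x => ?_⟩
    · simp only [_root_.smul_apply, _root_.sum_apply,
        MultilinearMap.domDomCongr_apply]
      congr 1
      exact Fintype.sum_equiv (Equiv.mulLeft τ) _ _ fun σ => rfl
    · have hne : (Fintype.card (Equiv.Perm (Fin n)) : 𝕜) ≠ 0 :=
        Nat.cast_ne_zero.2 Fintype.card_ne_zero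
      simp only [_root_.smul_apply, _root_.sum_apply,
        MultilinearMap.domDomCongr_apply, Finset.sum_const, Finset.card_univ, ← hA,
        ← Nat.cast_smul_eq_nsmul 𝕜]
      rw [inv_smul_smul₀ hne]

/-- The `(m + 1)`-homogeneous polynomial `x ↦ ℓ x ^ m • T x`. -/
noncomputable def powSMul (m : ℕ) (ℓ : NormedDual 𝕜 E) (T : E →L[𝕜] F) :
    ContHomPoly 𝕜 (m + 1) E F :=
  ofMultilinear (fun x => ℓ x ^ m • T x) (by fun_prop)
    (LinearMap.uncurryLeft
      { toFun := fun x => ((MultilinearMap.mkPiAlgebra 𝕜 (Fin m) 𝕜).compLinearMap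
          fun _ => (ℓ : E →ₗ[𝕜] 𝕜)).smulRight (T x)
        map_add' := fun x y => by ext v; simp
        map_smul' := fun c x => by ext v; simp [smul_comm c] })
    fun x => by simp [Fin.tail_def]

@[simp] theorem powSMul_apply (m : ℕ) (ℓ : NormedDual 𝕜 E) (T : E →L[𝕜] F) (x : E) :
    powSMul m ℓ T x = ℓ x ^ m • T x := rfl

theorem norm_powSMul_le (m : ℕ) (ℓ : NormedDual 𝕜 E) (T : E →L[𝕜] F) {a b : ℝ} (ha : 0 ≤ a)
    (hb : 0 ≤ b) (hℓ : ∀ x, ‖ℓ x‖ ≤ a * ‖x‖) (hT : ∀ x, ‖T x‖ ≤ b * ‖x‖) :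
    ‖powSMul m ℓ T‖ ≤ a ^ m * b := by
  refine norm_le_of_forall _ fun x hx => ?_
  rw [powSMul_apply, norm_smul, norm_pow]
  have h1 : ‖ℓ x‖ ≤ a := (hℓ x).trans (mul_le_of_le_one_right ha hx)
  have h2 : ‖T x‖ ≤ b := (hT x).trans (mul_le_of_le_one_right hb hx)
  gcongr

theorem powSMul_smulRight_mem_wPoly (m : ℕ) (ℓ : NormedDual 𝕜 E) (z : F) :
    powSMul m ℓ (ℓ.smulRight z) ∈ wPoly 𝕜 (m + 1) E F := by
  intro s _
  have h : Continuous fun x : WeakSpace 𝕜 E => ℓ ((toWeakSpace 𝕜 E).symm x) :=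
    WeakBilin.eval_continuous (topDualPairing 𝕜 E).flip ℓ
  exact ((h.pow m).smul (h.smul continuous_const)).continuousOn

/-- The weak-star limit of the values of polynomials along an ultrafilter on a ball. -/
theorem exists_ultrafilter_limit (U : Ultrafilter E) {r : ℝ} (hr : 0 < r)
    (hU : Metric.ball 0 r ∈ U) :
    ∃ Λ : ContHomPoly 𝕜 n E F →L[𝕜] NormedDual 𝕜 (NormedDual 𝕜 F),
      (∀ P (ψ : NormedDual 𝕜 F), Tendsto (fun x => ψ (P x)) U (𝓝 (Λ P ψ))) ∧ ‖Λ‖ ≤ r ^ n := by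
  have hex : ∀ (P : ContHomPoly 𝕜 n E F) (ψ : NormedDual 𝕜 F),
      ∃ c, Tendsto (fun x => ψ (P x)) U (𝓝 c) ∧ ‖c‖ ≤ r ^ n * ‖P‖ * ‖ψ‖ := by
    intro P ψ
    refine U.exists_tendsto_of_norm_le ?_
    filter_upwards [hU] with x hx
    calc ‖ψ (P x)‖ ≤ ‖ψ‖ * ‖P x‖ := ψ.le_opNorm _
      _ ≤ ‖ψ‖ * (r ^ n * ‖P‖) := by
        gcongr
        exact P.norm_apply_le hr (mem_ball_zero_iff.1 hx).le
      _ = r ^ n * ‖P‖ * ‖ψ‖ := mul_comm _ _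
  choose L hL hLb using hex
  let B : ContHomPoly 𝕜 n E F →ₗ[𝕜] NormedDual 𝕜 F →ₗ[𝕜] 𝕜 := LinearMap.mk₂ 𝕜 L
    (fun P Q ψ => tendsto_nhds_unique (hL (P + Q) ψ) (by simpa using (hL P ψ).add (hL Q ψ)))
    (fun c P ψ => tendsto_nhds_unique (hL (c • P) ψ) (by simpa using (hL P ψ).const_mul c))
    (fun P ψ χ => tendsto_nhds_unique (hL P (ψ + χ)) (by simpa using (hL P ψ).add (hL P χ)))
    (fun c P ψ => tendsto_nhds_unique (hL P (c • ψ)) (by simpa using (hL P ψ).const_mul c))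
  exact ⟨B.mkContinuous₂ (r ^ n) hLb, hL, B.mkContinuous₂_norm_le (by positivity) hLb⟩

end ContHomPoly

/-! ### Transfer of the HB inequalities to the third dual -/

section HBSubspace

variable {𝕜 : Type*} [RCLike 𝕜] {E F : Type*} [NormedAddCommGroup E] [NormedSpace 𝕜 E]
  [NormedAddCommGroup F] [NormedSpace 𝕜 F]

/-- A functional attaining its norm on the subspace is fixed by an HB-projection. -/
theorem apply_eq_self_of_norm_le_of_forall {X : Type*} [NormedAddCommGroup X] [NormedSpace 𝕜 X]
    {q : NormedDual 𝕜 X →L[𝕜] NormedDual 𝕜 X}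
    (hq : ∀ f, f ≠ q f → ‖q f‖ < ‖f‖ ∧ ‖f - q f‖ ≤ ‖f‖) {f : NormedDual 𝕜 X}
    (h : ‖f‖ ≤ ‖q f‖) : q f = f := by
  by_contra hne
  exact ((hq f (Ne.symm hne)).1.trans_le h).false

/-- The norm estimates for a functional on the bidual that does not agree with its weak-star
continuous part at a point `Y`. -/
theorem norm_estimates_of_wPoly_isHBSubspace [CompleteSpace F] {ρ : E →L[𝕜] F}
    (hρ : IsQuotientMapping ρ) {m : ℕ} (hHB : IsHBSubspace (wPoly 𝕜 (m + 1) E F))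
    (f : NormedDual 𝕜 (NormedDual 𝕜 (NormedDual 𝕜 F))) {g : NormedDual 𝕜 F}
    (hg : ∀ y, f (NormedSpace.inclusionInDoubleDual 𝕜 F y) = g y)
    {Y : NormedDual 𝕜 (NormedDual 𝕜 F)} (hY : f Y - Y g ≠ 0) :
    ‖g‖ < ‖f‖ ∧ ‖f Y - Y g‖ ≤ ‖f‖ * ‖Y‖ := by
  obtain ⟨-, q, hqq, hker, hq⟩ := hHB
  have hY0 : Y ≠ 0 := by
    rintro rfl
    simp at hY
  have hR : 0 < ‖Y‖ := norm_pos_iff.2 hY0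
  obtain ⟨U, hball, hU⟩ := hρ.exists_ultrafilter hY0
  obtain ⟨Λ, hΛ, hΛn⟩ := ContHomPoly.exists_ultrafilter_limit (𝕜 := 𝕜) (n := m + 1) (F := F)
    U hR hball
  let Φ : NormedDual 𝕜 (ContHomPoly 𝕜 (m + 1) E F) := f ∘L Λ
  let Γ : NormedDual 𝕜 (ContHomPoly 𝕜 (m + 1) E F) :=
    NormedSpace.inclusionInDoubleDual 𝕜 (NormedDual 𝕜 F) g ∘L Λ
  have hΦ : ∀ P, Φ P = f (Λ P) := fun P => rfl
  have hΓ : ∀ P, Γ P = Λ P g := fun P => rfl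
  have hΦn : ‖Φ‖ ≤ ‖f‖ * ‖Y‖ ^ (m + 1) :=
    (ContinuousLinearMap.opNorm_comp_le _ _).trans (by gcongr)
  have hΓn : ‖Γ‖ ≤ ‖g‖ * ‖Y‖ ^ (m + 1) := by
    refine (ContinuousLinearMap.opNorm_comp_le _ _).trans ?_
    gcongr
    exact NormedSpace.double_dual_bound 𝕜 _ g
  have hagree : ∀ P ∈ wPoly 𝕜 (m + 1) E F, Φ P = Γ P := by
    intro P hP
    obtain ⟨z, hz⟩ := WeaklyContinuousOnBounded.exists_tendsto (𝕜 := 𝕜) (U := U) hball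
      (fun ψ => by
        obtain ⟨c, hc, -⟩ := U.exists_tendsto_of_norm_le (g := ψ) (C := ‖ψ‖ * ‖Y‖) (by
          filter_upwards [hball] with x hx
          exact ψ.le_opNorm_of_le (mem_ball_zero_iff.1 hx).le)
        exact ⟨c, hc⟩) P.hasDiffDegreeLE hP
    have hΛP : Λ P = NormedSpace.inclusionInDoubleDual 𝕜 F z := by
      ext ψ
      exact tendsto_nhds_unique (hΛ P ψ) ((ψ.continuous.tendsto z).comp hz)
    rw [hΦ, hΓ, hΛP, hg]
    rfl
  have hqΦ : q Φ = q Γ := by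
    rw [← sub_eq_zero, ← map_sub, hker]
    intro P hP
    rw [_root_.sub_apply, hagree P hP, sub_self]
  have hqΓ : ∀ P ∈ wPoly 𝕜 (m + 1) E F, q Γ P = Γ P := by
    intro P hP
    -- Idempotence puts `q Γ - Γ` in the kernel, which is the annihilator.
    have h : q (q Γ - Γ) = 0 := by rw [map_sub, hqq, sub_self]
    exact sub_eq_zero.1 ((hker _).1 h P hP)
  have hρn : ∀ (φ : NormedDual 𝕜 F) (x : E), ‖(φ ∘L ρ) x‖ ≤ ‖φ‖ * ‖x‖ := fun φ x =>
    φ.le_opNorm_of_le (hρ.norm_apply_le x)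
  -- Since `q Γ` agrees with `Γ` on the subspace, finite-type polynomials bound its norm below by
  -- the upper bound `hΓn` for `‖Γ‖`.
  have hlower : ‖g‖ * ‖Y‖ ^ (m + 1) ≤ ‖q Γ‖ := by
    rw [← le_div_iff₀ (pow_pos hR _)]
    refine g.opNorm_le_bound (by positivity) fun z => ?_
    rw [div_mul_eq_mul_div, le_div_iff₀ (pow_pos hR _), mul_comm]
    refine norm_pow_mul_le_of_forall hY0 (m + 1) (norm_nonneg _) (by positivity) fun φ => ?_
    let P := ContHomPoly.powSMul m (φ ∘L ρ) ((φ ∘L ρ).smulRight z)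
    have hP : Γ P = Y φ ^ (m + 1) * g z := by
      refine tendsto_nhds_unique (hΛ P g) ?_
      have := ((hU φ).pow (m + 1)).mul_const (g z)
      refine this.congr fun x => ?_
      simp [P, pow_succ, mul_assoc]
    have hPn : ‖P‖ ≤ ‖φ‖ ^ m * (‖φ‖ * ‖z‖) := by
      refine ContHomPoly.norm_powSMul_le m _ _ (by positivity) (by positivity) (hρn φ) fun x => ?_
      rw [ContinuousLinearMap.smulRight_apply, norm_smul, mul_right_comm]
      gcongr
      exact hρn φ x
    calc ‖Y φ‖ ^ (m + 1) * ‖g z‖ = ‖q Γ P‖ := by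
          rw [hqΓ P (ContHomPoly.powSMul_smulRight_mem_wPoly m _ z), hP, norm_mul, norm_pow]
      _ ≤ ‖q Γ‖ * (‖φ‖ ^ m * (‖φ‖ * ‖z‖)) := (q Γ).le_opNorm_of_le hPn
      _ = ‖q Γ‖ * ‖z‖ * ‖φ‖ ^ (m + 1) := by ring
  have hfix : q Γ = Γ := apply_eq_self_of_norm_le_of_forall hq (hΓn.trans hlower)
  have htest : ∀ φ : NormedDual 𝕜 F, (Φ - Γ) (ContHomPoly.powSMul m (φ ∘L ρ) ρ)
      = Y φ ^ m * (f Y - Y g) := by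
    intro φ
    have hΛP : Λ (ContHomPoly.powSMul m (φ ∘L ρ) ρ) = Y φ ^ m • Y := by
      ext ψ
      refine tendsto_nhds_unique (hΛ _ ψ) ?_
      refine (((hU φ).pow m).mul (hU ψ)).congr fun x => ?_
      simp
    rw [_root_.sub_apply, hΦ, hΓ, hΛP, map_smul, _root_.smul_apply,
      smul_eq_mul, smul_eq_mul, mul_sub]
  have hne : Φ ≠ q Φ := by
    rw [hqΦ, hfix]
    intro h
    obtain ⟨φ, hφ⟩ : ∃ φ, Y φ ≠ 0 := by
      by_contra! hall
      exact hY0 (ContinuousLinearMap.ext hall)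
    have := htest φ
    rw [h, sub_self, _root_.zero_apply] at this
    exact mul_ne_zero (pow_ne_zero m hφ) hY this.symm
  obtain ⟨h1, h2⟩ := hq Φ hne
  rw [hqΦ] at h1 h2
  constructor
  · exact lt_of_mul_lt_mul_right (hlower.trans_lt (h1.trans_le hΦn)) (pow_pos hR _).le
  · rw [hfix] at h2
    have h3 : ‖Y‖ ^ m * ‖f Y - Y g‖ ≤ ‖Φ - Γ‖ :=
      norm_pow_mul_le_of_forall hY0 m (norm_nonneg _) (norm_nonneg _) fun φ => by
        rw [← norm_pow, ← norm_mul, ← htest]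
        refine (Φ - Γ).le_opNorm_of_le ?_
        rw [← mul_one (‖φ‖ ^ m)]
        exact ContHomPoly.norm_powSMul_le m _ _ (norm_nonneg φ) zero_le_one (hρn φ) fun x => by
          rw [one_mul]
          exact hρ.norm_apply_le x
    refine le_of_mul_le_mul_left ?_ (pow_pos hR m)
    calc ‖Y‖ ^ m * ‖f Y - Y g‖ ≤ ‖f‖ * ‖Y‖ ^ (m + 1) := h3.trans (h2.trans hΦn)
      _ = ‖Y‖ ^ m * (‖f‖ * ‖Y‖) := by ring

end HBSubspace

theorem proposition4p4 {𝕜 : Type*} [RCLike 𝕜] {E F : Type*}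
    [NormedAddCommGroup E] [NormedSpace 𝕜 E] [CompleteSpace E]
    [NormedAddCommGroup F] [NormedSpace 𝕜 F] [CompleteSpace F]
    (hρ : ∃ ρ : E →L[𝕜] F, IsQuotientMapping ρ)
    (hHB : ∃ n : ℕ, 1 ≤ n ∧ IsHBSubspace (wPoly 𝕜 n E F)) :
    IsHBSubspace (𝕜 := 𝕜) (X := StrongDual 𝕜 (StrongDual 𝕜 F))
      (NormedSpace.inclusionInDoubleDual 𝕜 F).range := by
  obtain ⟨ρ, hρ⟩ := hρ
  obtain ⟨n, hn, hHB⟩ := hHB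
  -- One of the `n = m + 1` factors is reserved for the vector-valued map; this is where `n ≥ 1`
  -- enters.
  obtain ⟨m, rfl⟩ := Nat.exists_eq_add_of_le' hn
  let ι := NormedSpace.inclusionInDoubleDual 𝕜 F
  let restr : NormedDual 𝕜 (NormedDual 𝕜 (NormedDual 𝕜 F)) →L[𝕜] NormedDual 𝕜 F :=
    (ContinuousLinearMap.compL 𝕜 F (NormedDual 𝕜 (NormedDual 𝕜 F)) 𝕜).flip ι
  let π := NormedSpace.inclusionInDoubleDual 𝕜 (NormedDual 𝕜 F) ∘L restr
  have hrestr : ∀ f y, restr f y = f (ι y) := fun f y => rfl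
  have hπ : ∀ f Y, π f Y = Y (restr f) := fun f Y => rfl
  have hrπ : ∀ f, restr (π f) = restr f := fun f => rfl
  refine ⟨?_, π, fun f => ?_, fun f => ?_, fun f hf => ?_⟩
  · have h : Isometry (β := NormedDual 𝕜 (NormedDual 𝕜 F)) ι :=
      (NormedSpace.inclusionInDoubleDualLi (E := F) 𝕜).isometry
    exact h.isClosedEmbedding.isClosed_range
  · ext Y
    rw [hπ, hπ, hrπ]
  · refine ⟨?_, fun h => ?_⟩
    · rintro h _ ⟨y, rfl⟩
      change restr f y = 0
      rw [← hrπ, h]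
      simp
    · have : restr f = 0 := by
        ext y
        exact h _ ⟨y, rfl⟩
      ext Y
      rw [hπ, this, map_zero]
      rfl
  · have hest : ∀ Y, f Y - Y (restr f) ≠ 0 →
        ‖restr f‖ < ‖f‖ ∧ ‖f Y - Y (restr f)‖ ≤ ‖f‖ * ‖Y‖ := fun Y hY =>
      norm_estimates_of_wPoly_isHBSubspace hρ hHB f (fun y => (hrestr f y).symm) hY
    constructor
    · obtain ⟨Y, hY⟩ : ∃ Y, f Y ≠ π f Y := by
        by_contra! hall
        exact hf (ContinuousLinearMap.ext hall)
      exact (NormedSpace.double_dual_bound 𝕜 _ _).trans_lt (hest Y (sub_ne_zero.2 hY)).1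
    · refine ContinuousLinearMap.opNorm_le_bound _ (norm_nonneg f) fun Y => ?_
      rw [_root_.sub_apply, hπ]
      by_cases hY : f Y - Y (restr f) = 0
      · rw [hY, norm_zero]
        positivity
      · exact (hest Y hY).2
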